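/- Let $n\ge 0$, let $\mathfrak B_n$ be the braid group on $n$ strands with Artin generators $\sigma_1,\dots,\sigma_{n-1}$, let $\sigma\in\mathfrak B_n$, and let $\beta$ be any word in the $\sigma_i^{\pm1}$ representing $\sigma$. Let $\mathcal P$ be the diagram in $S^2\setminus\{\mathbb X,\mathbb O\}$ of the annular closure $\widehat\sigma$ of $\sigma$ obtained by closing up the diagram of $\beta$, a letter $\sigma_i$ being a positive crossing and $\sigma_i^{-1}$ a negative one, with the braid-like orientation $o_\uparrow$, in which all strands wind counterclockwise about $\mathbb X$. Let $(\mathcal C,\partial^{Lee})$ be the Lee complex of $\mathcal P$ over $\mathbb C$. Its underlying vector space has a distinguished basis: the complete resolutions of $\mathcal P$ with each circle marked $v_+$ or $v_-$. The differential is the signed sum over the edges of the cube of resolutions of the maps induced by the multiplication $v_+v_+=v_+$, $v_+v_-=v_-v_+=v_-$, $v_-v_-=v_+$ and the comultiplication $v_+\mapsto v_+\otimes v_-+v_-\otimes v_+$, $v_-\mapsto v_-\otimes v_-+v_+\otimes v_+$. For a basis element $\mathbf x$ at a vertex of the cube with $r$ crossings $1$-resolved, let $$j(\mathbf x)=\#\{v_+\}-\#\{v_-\}+r+n_+-2n_-,$$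 where $n_\pm$ is the number of positive/negative crossings, and let $k(\mathbf x)$ be the number of $v_+$-marked minus the number of $v_-$-marked nontrivial circles, a circle being nontrivial if it separates $\mathbb X$ from $\mathbb O$. For $t\in[0,2]$ put $j_t(\mathbf x)=j(\mathbf x)-t\,k(\mathbf x)$. For a nonzero chain $x$ let $\mathrm{gr}_{j_t}(x)$ be the minimum of $j_t$ over the basis elements occurring in $x$, and for a nonzero class $\eta\in H_*(\mathcal C,\partial^{Lee})$ let $\mathrm{gr}_{j_t}(\eta)=\max_{[x]=\eta}\mathrm{gr}_{j_t}(x)$. Let $\mathfrak s_{o_\uparrow}$ be the canonical Lee cycle: the braid-like (oriented) resolution, which consists of $n$ concentric circles, with the outermost circle marked $\mathbf b=v_--v_+$ and the circles marked alternately $\mathbf b$ and $\mathbf a=v_-+v_+$ from the outermost to the innermost. Define $$d_t(\widehat\sigma)=\mathrm{gr}_{j_t}([\mathfrak s_{o_\uparrow}])\quad(t\in[0,2]),\qquad m_t(\widehat\sigma)=\lim_{\epsilon\to0^+}\frac{d_{t+\epsilon}(\widehat\sigma)-d_t(\widehat\sigma)}{\epsilon}\quad(t\in[0,2)).$$ If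 $m_{t_0}(\widehat\sigma)=n$ for some $t_0\in[0,1)$, then $m_t(\widehat\sigma)=n$ for all $t\in[t_0,1)$. -/

import Mathlib

open Filter Topology

noncomputable section

namespace AnnularLee

/-- Relators of the Artin presentation of the braid group on `n` strands
(generators are indexed from `0` to `n - 2`): far commutation and the braid relation. -/
def braidRels (n : ℕ) : Set (FreeGroup (Fin (n - 1))) :=
  {r | ∃ i j : Fin (n - 1), i.val + 2 ≤ j.val ∧
      r = FreeGroup.of i * FreeGroup.of j * (FreeGroup.of j * FreeGroup.of i)⁻¹} ∪
  {r | ∃ i j : Fin (n - 1), i.val + 1 = j.val ∧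
      r = FreeGroup.of i * FreeGroup.of j * FreeGroup.of i *
        (FreeGroup.of j * FreeGroup.of i * FreeGroup.of j)⁻¹}

/-- The braid group on `n` strands. -/
abbrev BraidGroup (n : ℕ) : Type := PresentedGroup (braidRels n)

/-- A word in the Artin generators: `(i, true)` is the `i`-th generator (a positive crossing of
the strands in positions `i` and `i + 1`), `(i, false)` is its inverse (a negative crossing). -/
abbrev BraidWord (n : ℕ) : Type := List (Fin (n - 1) × Bool)

/-- The braid represented by a word. -/
def braidOf {n : ℕ} (w : BraidWord n) : BraidGroup n :=
  PresentedGroup.mk (braidRels n) (FreeGroup.mk w)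

variable {n : ℕ}

/-! ### The closure diagram and its Kauffman states

The diagram of the annular closure of a word `w` of length `l` has levels `0, …, l`, with the
crossing number `p` between the levels `p` and `p + 1`; the level `l` is joined to the level `0` by
`n` parallel closing arcs. The strands wind counterclockwise around the inner basepoint, position
`0` is the innermost one and position `n - 1` the outermost one. The arc from the inner to the outer
basepoint is chosen to cross the `n` closing arcs, once each. -/

/-- The marked points of the closure diagram: `(level, position)`. -/
abbrev Pt (w : BraidWord n) : Type := Fin (w.length + 1) × Fin n

/-- The position of the left (inner) strand at the crossing `p`. -/
def posL (w : BraidWord n) (p : Fin w.length) : Fin n :=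
  ⟨(w.get p).1.val, by have := (w.get p).1.isLt; omega⟩

/-- The position of the right (outer) strand at the crossing `p`. -/
def posR (w : BraidWord n) (p : Fin w.length) : Fin n :=
  ⟨(w.get p).1.val + 1, by have := (w.get p).1.isLt; omega⟩

/-- A vertex of the cube of resolutions; `false` is the `0`-resolution and `true` is the
`1`-resolution. -/
abbrev Vertex (w : BraidWord n) : Type := Fin w.length → Bool

/-- The crossing `p` is resolved compatibly with the braid-like orientation. The oriented resolution
is the `0`-resolution of a positive crossing and the `1`-resolution of a negative crossing. -/
def Braidlike (w : BraidWord n) (v : Vertex w) (p : Fin w.length) : Prop :=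
  v p = !(w.get p).2

/-- The arcs of the complete resolution at the vertex `v`. -/
inductive Arc (w : BraidWord n) (v : Vertex w) : Pt w → Pt w → Prop
  | closing (j : Fin n) : Arc w v (Fin.last w.length, j) (0, j)
  | strand (p : Fin w.length) (j : Fin n) (hL : j ≠ posL w p) (hR : j ≠ posR w p) :
      Arc w v (p.castSucc, j) (p.succ, j)
  | vertL (p : Fin w.length) (h : Braidlike w v p) :
      Arc w v (p.castSucc, posL w p) (p.succ, posL w p)
  | vertR (p : Fin w.length) (h : Braidlike w v p) :
      Arc w v (p.castSucc, posR w p) (p.succ, posR w p)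
  | horizBot (p : Fin w.length) (h : ¬ Braidlike w v p) :
      Arc w v (p.castSucc, posL w p) (p.castSucc, posR w p)
  | horizTop (p : Fin w.length) (h : ¬ Braidlike w v p) :
      Arc w v (p.succ, posL w p) (p.succ, posR w p)

/-- The circles of the complete resolution at `v`: the classes of marked points under the
equivalence relation generated by the arcs. -/
def Circle (w : BraidWord n) (v : Vertex w) : Type := Quot (Arc w v)

/-- The circle through a marked point. -/
def circ (w : BraidWord n) (v : Vertex w) (x : Pt w) : Circle w v := Quot.mk _ x

instance (w : BraidWord n) (v : Vertex w) : Finite (Circle w v) :=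
  inferInstanceAs (Finite (Quot (Arc w v)))

instance (w : BraidWord n) (v : Vertex w) : Fintype (Circle w v) := Fintype.ofFinite _

/-- A circle is nontrivial if it meets the arc joining the basepoints an odd number of times. -/
def Nontriv (w : BraidWord n) (v : Vertex w) (c : Circle w v) : Prop :=
  Odd (Nat.card {j : Fin n // circ w v (0, j) = c})

/-! ### The annular Khovanov-Lee complex -/

/-- The distinguished basis: complete resolutions whose circles are marked with `v₊` (`true`) or
`v₋` (`false`). -/
abbrev State (w : BraidWord n) : Type := Σ v : Vertex w, (Circle w v → Bool)

open scoped Classical in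
instance (w : BraidWord n) : Fintype (State w) := inferInstance

/-- The complex vector space underlying the complex. -/
abbrev Chain (w : BraidWord n) : Type := State w → ℂ

/-- The coefficient of the third marking in the product of the first two, for Lee's multiplication
`v₊v₊ = v₊`, `v₊v₋ = v₋v₊ = v₋`, `v₋v₋ = v₊` (the last one is the Lee deformation). -/
def mulCoeff : Bool → Bool → Bool → ℂ
  | true, true, true => 1
  | true, false, false => 1
  | false, true, false => 1
  | false, false, true => 1
  | _, _, _ => 0

/-- The coefficient of the tensor product of the last two markings in the coproduct of the first
one, for Lee's comultiplication `v₊ ↦ v₊ ⊗ v₋ + v₋ ⊗ v₊`, `v₋ ↦ v₋ ⊗ v₋ + v₊ ⊗ v₊` (the last term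
is the Lee deformation). -/
def comulCoeff : Bool → Bool → Bool → ℂ
  | true, true, false => 1
  | true, false, true => 1
  | false, false, false => 1
  | false, true, true => 1
  | _, _, _ => 0

/-- The bottom left corner of the crossing `p`. -/
def cornerA (w : BraidWord n) (p : Fin w.length) : Pt w := (p.castSucc, posL w p)

/-- The top right corner of the crossing `p`. In both resolutions of `p` the two arcs replacing `p`
are the one through `cornerA` and the one through `cornerB`. -/
def cornerB (w : BraidWord n) (p : Fin w.length) : Pt w := (p.succ, posR w p)

open scoped Classical in
/-- The matrix coefficient, without the sign, of the edge map that changes the resolution of the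
crossing `p`: a merge if two different circles of the source pass through `p`, a split otherwise,
and the identity on the markings of the circles that do not pass through `p`. -/
def edgeCoeff (w : BraidWord n) (p : Fin w.length) (S T : State w) : ℂ :=
  let a := circ w S.1 (cornerA w p)
  let b := circ w S.1 (cornerB w p)
  let a' := circ w T.1 (cornerA w p)
  let b' := circ w T.1 (cornerB w p)
  if ∀ x : Pt w, circ w S.1 x ≠ a → circ w S.1 x ≠ b → T.2 (circ w T.1 x) = S.2 (circ w S.1 x) then
    if a ≠ b then mulCoeff (S.2 a) (S.2 b) (T.2 a')
    else comulCoeff (S.2 a) (T.2 a') (T.2 b')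
  else 0

/-- The matrix coefficient of the Lee differential from `S` to `T`: the signed sum over the edges of
the cube from the vertex of `S` to the vertex of `T`. -/
def leeCoeff (w : BraidWord n) (S T : State w) : ℂ :=
  ∑ p : Fin w.length,
    if S.1 p = false ∧ T.1 = Function.update S.1 p true then
      (-1 : ℂ) ^ (Finset.univ.filter fun q : Fin w.length => q < p ∧ S.1 q = true).card *
        edgeCoeff w p S T
    else 0

/-- The Lee differential. -/
def leeDiff (w : BraidWord n) : Chain w →ₗ[ℂ] Chain w :=
  Matrix.mulVecLin (Matrix.of fun T S : State w => leeCoeff w S T)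

/-! ### Gradings -/

/-- The number of positive crossings. -/
def nPos (w : BraidWord n) : ℕ := (Finset.univ.filter fun p : Fin w.length => (w.get p).2 = true).card

/-- The number of negative crossings. -/
def nNeg (w : BraidWord n) : ℕ :=
  (Finset.univ.filter fun p : Fin w.length => (w.get p).2 = false).card

/-- The degree `1` of `v₊` and `-1` of `v₋`. -/
def markDeg (b : Bool) : ℤ := if b then 1 else -1

/-- The quantum grading. -/
def jGr (w : BraidWord n) (S : State w) : ℤ :=
  (∑ c : Circle w S.1, markDeg (S.2 c)) +
    (Finset.univ.filter fun p : Fin w.length => S.1 p = true).card + nPos w - 2 * nNeg w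

open scoped Classical in
/-- The annular grading: the algebraic intersection number of the oriented Kauffman state (circles
marked `v₊` counterclockwise, circles marked `v₋` clockwise) with the arc joining the basepoints. A
trivial circle contributes `0` and a nontrivial one the degree of its marking. -/
def kGr (w : BraidWord n) (S : State w) : ℤ :=
  ∑ c : Circle w S.1, if Nontriv w S.1 c then markDeg (S.2 c) else 0

/-- The `j_t`-grading of a distinguished basis element. -/
def jtGr (w : BraidWord n) (t : ℝ) (S : State w) : ℝ := (jGr w S : ℝ) - t * (kGr w S : ℝ)

/-- The descending filtration of the chain space by the `j_t`-grading: the span of the basis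
elements of `j_t`-grading at least `s`. -/
def filt (w : BraidWord n) (t s : ℝ) : Set (Chain w) :=
  {x | ∀ S : State w, x S ≠ 0 → s ≤ jtGr w t S}

/-- The filtration grading of a nonzero chain. -/
def chainGr (w : BraidWord n) (t : ℝ) (x : Chain w) : ℝ := sSup {s : ℝ | x ∈ filt w t s}

/-! ### The canonical Lee cycle and the annular Rasmussen invariant -/

/-- The vertex of the braid-like resolution, all of whose circles are the `n` concentric ones. -/
def braidVertex (w : BraidWord n) : Vertex w := fun p => !(w.get p).2

/-- The coefficient of the marking `m` in the mark of the circle in position `j` of the braid-like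
resolution. The outermost circle (position `n - 1`) is marked `b = v₋ - v₊`, and the marks alternate
between `b` and `a = v₋ + v₊` from the outermost to the innermost circle. -/
def canonMark (n : ℕ) (j : Fin n) (m : Bool) : ℂ :=
  if Even (n - 1 - j.val) then (if m then -1 else 1) else 1

/-- The canonical Lee cycle of the braid-like orientation. -/
def canonCycle (w : BraidWord n) : Chain w := fun S =>
  if S.1 = braidVertex w then ∏ j : Fin n, canonMark n j (S.2 (circ w S.1 (0, j))) else 0

/-- The cycles that represent the canonical Lee homology class. -/
def canonReps (w : BraidWord n) : Set (Chain w) :=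
  {x | leeDiff w x = 0 ∧ x - canonCycle w ∈ LinearMap.range (leeDiff w)}

/-- The annular Rasmussen invariant `d_t` of the closure with its braid-like orientation: the
`j_t`-grading of the canonical Lee homology class. -/
def annularRasmussen (w : BraidWord n) (t : ℝ) : ℝ := sSup (chainGr w t '' canonReps w)

/-- The right-hand slope `m_t` of the annular Rasmussen invariant at `t` exists and equals `m`. -/
def HasRightSlope (w : BraidWord n) (t m : ℝ) : Prop :=
  Tendsto (fun ε : ℝ => (annularRasmussen w (t + ε) - annularRasmussen w t) / ε) (𝓝[>] 0) (𝓝 m)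

end AnnularLee

end

/-!
A basis state `S` has `|k(S)| ≤ n`, so `t ↦ j_t(S)` is `n`-Lipschitz, and hence so are the minima
and maxima of these functions, in particular `d_t`. If `k(S) = -n`, then the `n` closing arcs lie on
different circles, and this happens only in the braid-like resolution, where
`j_t(S) = sl + t n + (1 - t) (k(S) + n)` with `sl` the self-linking number of the closed braid. The
canonical cycle lives in this resolution, so `d_t ≥ sl + t n` for `t ≤ 1`. As the
canonical class is nonzero, the graph of `d_t` is contained in the union of the finitely many lines
`j_t(S)`, so slope `n` at `t₀` means that `d_{t₀} = j_{t₀}(S)` for a state `S` with `k(S) = -n`,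
that is, `d_{t₀} = sl + t₀ n`. From there on `d_t` grows at most at rate `n` and stays above the
line `sl + t n` until `t = 1`, so it runs along this line.
-/

lemma sum_eq_zero_of_perm_neg {ι M : Type*} [Fintype ι] [AddCommGroup M] [IsAddTorsionFree M]
    {f : ι → M} (e : Equiv.Perm ι) (h : ∀ i, f (e i) = -f i) : ∑ i, f i = 0 := by
  rw [← self_eq_neg, ← Finset.sum_neg_distrib]
  exact (Equiv.sum_comp e f).symm.trans (Finset.sum_congr rfl fun i _ => h i)

lemma exists_accPt_sep {X ι : Type*} [TopologicalSpace X] [Finite ι] {s : Set X}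
    {x : X} {P : ι → X → Prop} (hx : AccPt x (𝓟 s)) (hP : ∀ y ∈ s, ∃ i, P i y) :
    ∃ i, AccPt x (𝓟 {y ∈ s | P i y}) := by
  simp only [accPt_iff_frequently] at hx ⊢
  refine frequently_exists.1 (hx.mono fun y ⟨hne, hys⟩ => ?_)
  obtain ⟨i, hi⟩ := hP y hys
  exact ⟨i, hne, hys, hi⟩

lemma exists_eq_and_deriv_eq_of_hasDerivWithinAt {𝕜 F ι : Type*} [NontriviallyNormedField 𝕜]
    [NormedAddCommGroup F] [NormedSpace 𝕜 F] [Finite ι] {f : 𝕜 → F} {g : ι → 𝕜 → F} {f' : F}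
    {g' : ι → F} {s : Set 𝕜} {x : 𝕜} (hx : AccPt x (𝓟 s)) (hfg : ∀ y ∈ s, ∃ i, f y = g i y)
    (hf : HasDerivWithinAt f f' s x) (hg : ∀ i, HasDerivWithinAt (g i) (g' i) s x) :
    ∃ i, f x = g i x ∧ f' = g' i := by
  obtain ⟨i, hi⟩ := exists_accPt_sep hx hfg
  have hfi : HasDerivWithinAt f f' {y ∈ s | f y = g i y} x := hf.mono (Set.sep_subset _ _)
  have hgi : HasDerivWithinAt (g i) (g' i) {y ∈ s | f y = g i y} x :=
    (hg i).mono (Set.sep_subset _ _)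
  have hval : f x = g i x := by
    have := accPt_principal_iff_nhdsWithin.1 hi
    exact tendsto_nhds_unique_of_eventuallyEq
      (hfi.continuousWithinAt.mono (Set.sdiff_subset (t := {x})))
      (hgi.continuousWithinAt.mono Set.sdiff_subset)
      (eventually_mem_nhdsWithin.mono fun y hy => hy.1.2)
  exact ⟨i, hval, hi.uniqueDiffWithinAt.eq_deriv _ hfi (hgi.congr (fun y hy => hy.2) hval)⟩

namespace AnnularLee

variable {n : ℕ} {w : BraidWord n}

/-! ### Circles of the resolutions -/

lemma posL_ne_posR (p : Fin w.length) : posL w p ≠ posR w p := by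
  simp [posL, posR, Fin.ext_iff]

lemma circ_last (w : BraidWord n) (v : Vertex w) (j : Fin n) :
    circ w v (Fin.last w.length, j) = circ w v (0, j) :=
  Quot.sound (Arc.closing j)

lemma circ_succ_of_braidlike {v : Vertex w} {p : Fin w.length} (hp : Braidlike w v p) (j : Fin n) :
    circ w v (p.succ, j) = circ w v (p.castSucc, j) := by
  refine (Quot.sound ?_).symm
  rcases eq_or_ne j (posL w p) with rfl | hL
  · exact Arc.vertL p hp
  rcases eq_or_ne j (posR w p) with rfl | hR
  · exact Arc.vertR p hp
  · exact Arc.strand p j hL hR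

lemma circ_castSucc_posL_eq_posR {v : Vertex w} {p : Fin w.length} (hp : ¬ Braidlike w v p) :
    circ w v (p.castSucc, posL w p) = circ w v (p.castSucc, posR w p) :=
  Quot.sound (Arc.horizBot p hp)

lemma circ_eq_of_braidlike_below {v : Vertex w} {q : Fin (w.length + 1)}
    (hq : ∀ p : Fin w.length, p.castSucc < q → Braidlike w v p) (j : Fin n) :
    circ w v (q, j) = circ w v (0, j) := by
  induction q using Fin.induction with
  | zero => rfl
  | succ p ih =>
    rw [circ_succ_of_braidlike (hq p p.castSucc_lt_succ),
      ih fun r hr => hq r (hr.trans p.castSucc_lt_succ)]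

lemma circ_eq_of_braidlike_above {v : Vertex w} {q : Fin (w.length + 1)}
    (hq : ∀ p : Fin w.length, q ≤ p.castSucc → Braidlike w v p) (j : Fin n) :
    circ w v (q, j) = circ w v (0, j) := by
  induction q using Fin.reverseInduction with
  | last => exact circ_last w v j
  | cast p ih =>
    rw [← circ_succ_of_braidlike (hq p le_rfl),
      ih fun r hr => hq r (p.castSucc_lt_succ.le.trans hr)]

lemma circ_eq_of_subsingleton_not_braidlike {v : Vertex w}
    (hv : {p | ¬ Braidlike w v p}.Subsingleton) (x : Pt w) :
    circ w v x = circ w v (0, x.2) := by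
  by_cases hbelow : ∀ p : Fin w.length, p.castSucc < x.1 → Braidlike w v p
  · exact circ_eq_of_braidlike_below hbelow x.2
  push Not at hbelow
  obtain ⟨p, hpx, hp⟩ := hbelow
  refine circ_eq_of_braidlike_above (fun r hr => ?_) x.2
  by_contra hbad
  exact (hpx.trans_le hr).ne (congrArg Fin.castSucc (hv hp hbad))

lemma eq_braidVertex_of_injective {v : Vertex w}
    (h : Function.Injective fun j : Fin n => circ w v (0, j)) : v = braidVertex w := by
  funext p
  induction p using WellFoundedLT.induction with
  | _ p ih =>
    by_contra hp
    have hbelow := circ_eq_of_braidlike_below (v := v) (q := p.castSucc) fun r hr => ih r hr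
    refine posL_ne_posR p (h ?_)
    simpa only [hbelow] using circ_castSucc_posL_eq_posR hp

/-- The position of a circle of the braid-like resolution among the `n` concentric ones. -/
def circlePos (w : BraidWord n) : Circle w (braidVertex w) → Fin n :=
  Quot.lift Prod.snd fun _ _ h => by
    cases h with
    | horizBot p h => exact absurd rfl h
    | horizTop p h => exact absurd rfl h
    | _ => rfl

lemma circ_braidVertex_eq_iff (x y : Pt w) :
    circ w (braidVertex w) x = circ w (braidVertex w) y ↔ x.2 = y.2 := by
  have hbase : ∀ z, circ w (braidVertex w) z = circ w (braidVertex w) (0, z.2) :=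
    circ_eq_of_subsingleton_not_braidlike fun p hp => absurd rfl hp
  refine ⟨fun h => congrArg (circlePos w) h, fun h => ?_⟩
  rw [hbase x, h, ← hbase y]

lemma nontriv_braidVertex (c : Circle w (braidVertex w)) : Nontriv w (braidVertex w) c := by
  obtain ⟨x, rfl⟩ := Quot.exists_rep c
  change Odd (Nat.card {j : Fin n // circ w (braidVertex w) (0, j) = circ w (braidVertex w) x})
  simp [circ_braidVertex_eq_iff]

/-! ### Gradings of the basis states -/

lemma exists_circ_eq_of_nontriv {v : Vertex w} {c : Circle w v} (h : Nontriv w v c) :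
    ∃ j : Fin n, circ w v (0, j) = c := by
  by_contra! hc
  have : IsEmpty {j : Fin n // circ w v (0, j) = c} := ⟨fun j => hc j.1 j.2⟩
  simp [Nontriv] at h

lemma abs_markDeg (b : Bool) : |markDeg b| = 1 := by cases b <;> rfl

open scoped Classical in
lemma abs_kGr_le_card_image (S : State w) :
    |kGr w S| ≤ (Finset.univ.image fun j : Fin n => circ w S.1 (0, j)).card := by
  have hsub : Finset.univ.filter (Nontriv w S.1) ⊆
      Finset.univ.image fun j : Fin n => circ w S.1 (0, j) := fun c hc => by
    simpa using exists_circ_eq_of_nontriv (Finset.mem_filter.1 hc).2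
  calc |kGr w S| ≤ ∑ c with Nontriv w S.1 c, |markDeg (S.2 c)| := by
        rw [kGr, ← Finset.sum_filter]
        exact Finset.abs_sum_le_sum_abs _ _
    _ = (Finset.univ.filter (Nontriv w S.1)).card := by simp [abs_markDeg]
    _ ≤ _ := by exact_mod_cast Finset.card_le_card hsub

lemma abs_kGr_le (S : State w) : |kGr w S| ≤ n := by
  classical
  refine (abs_kGr_le_card_image S).trans ?_
  exact_mod_cast Finset.card_image_le.trans_eq (Finset.card_fin n)

lemma eq_braidVertex_of_abs_kGr_eq {S : State w} (h : |kGr w S| = n) : S.1 = braidVertex w := by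
  classical
  have hle := abs_kGr_le_card_image S
  rw [h, Nat.cast_le] at hle
  refine eq_braidVertex_of_injective ?_
  rw [← Set.injOn_univ, ← Finset.coe_univ]
  exact Finset.card_image_iff.1 (Finset.card_image_le.antisymm (by simpa using hle))

/-- The self-linking number of the closed braid, as a transverse link: the writhe minus the number
of strands. -/
def selfLinking (w : BraidWord n) : ℤ := nPos w - nNeg w - n

lemma jGr_of_eq_braidVertex {S : State w} (h : S.1 = braidVertex w) :
    jGr w S = selfLinking w + (kGr w S + n) := by
  obtain ⟨v, m⟩ := S
  obtain rfl : v = braidVertex w := h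
  have hr : (Finset.univ.filter fun p : Fin w.length => braidVertex w p = true).card = nNeg w := by
    simp [nNeg, braidVertex]
  simp only [jGr, kGr, nontriv_braidVertex, if_true, hr, selfLinking]
  ring

lemma jtGr_of_eq_braidVertex {S : State w} (h : S.1 = braidVertex w) (t : ℝ) :
    jtGr w t S = selfLinking w + t * n + (1 - t) * (kGr w S + n) := by
  rw [jtGr, jGr_of_eq_braidVertex h]
  push_cast
  ring

lemma jtGr_of_kGr_eq_neg {S : State w} (h : kGr w S = -n) (t : ℝ) :
    jtGr w t S = selfLinking w + t * n := by
  rw [jtGr_of_eq_braidVertex (eq_braidVertex_of_abs_kGr_eq (by simp [h])), h]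
  simp

lemma jtGr_le_add (S : State w) (s t : ℝ) : jtGr w s S ≤ jtGr w t S + n * |s - t| := by
  have hk : |(kGr w S : ℝ)| ≤ n := by exact_mod_cast abs_kGr_le S
  calc jtGr w s S = jtGr w t S + (t - s) * kGr w S := by unfold jtGr; ring
    _ ≤ jtGr w t S + |t - s| * |(kGr w S : ℝ)| := by
        rw [← abs_mul]; gcongr; exact le_abs_self _
    _ ≤ jtGr w t S + n * |s - t| := by rw [abs_sub_comm, mul_comm]; gcongr

/-! ### The canonical class -/

open scoped Classical in
/-- The involution of the basis that changes the marks of the circles through the crossing `p`. It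
preserves the coefficients of the edges at `p` into and out of the braid-like resolution, and it
negates the canonical cycle, which marks these two circles differently. So the canonical cycle is a
cycle and, dually, pairs to zero with every boundary. It does not pair to zero with itself, so it is
not a boundary. -/
noncomputable def flipAt (w : BraidWord n) (p : Fin w.length) (S : State w) : State w :=
  ⟨S.1, fun c => if c = circ w S.1 (cornerA w p) ∨ c = circ w S.1 (cornerB w p)
    then !S.2 c else S.2 c⟩

lemma flipAt_involutive (w : BraidWord n) (p : Fin w.length) :
    Function.Involutive (flipAt w p) := fun S =>
  Sigma.ext rfl <| heq_of_eq <| funext fun c => by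
    by_cases hc : c = circ w S.1 (cornerA w p) ∨ c = circ w S.1 (cornerB w p)
    · exact (if_pos hc).trans ((congrArg not (if_pos hc)).trans (Bool.not_not _))
    · exact (if_neg hc).trans (if_neg hc)

lemma mulCoeff_not_not (a b c : Bool) : mulCoeff (!a) (!b) c = mulCoeff a b c := by
  cases a <;> cases b <;> cases c <;> rfl

lemma comulCoeff_not_not (a b c : Bool) : comulCoeff a (!b) (!c) = comulCoeff a b c := by
  cases a <;> cases b <;> cases c <;> rfl

/-- All edges out of the braid-like resolution are merges. -/
lemma edgeCoeff_flipAt_left (p : Fin w.length) {S : State w} (hS : S.1 = braidVertex w)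
    (T : State w) : edgeCoeff w p (flipAt w p S) T = edgeCoeff w p S T := by
  obtain ⟨v, m⟩ := S
  obtain rfl : v = braidVertex w := hS
  have hmerge : circ w (braidVertex w) (cornerA w p) ≠ circ w (braidVertex w) (cornerB w p) :=
    fun h => posL_ne_posR p ((circ_braidVertex_eq_iff _ _).1 h)
  simp only [edgeCoeff, flipAt, ne_eq, hmerge, not_false_eq_true, if_true, true_or, or_true,
    mulCoeff_not_not]
  congr 1
  refine propext (forall_congr' fun x => forall₂_congr fun hA hB => ?_)
  simp [hA, hB]

lemma not_braidlike_iff_of_update_eq {v : Vertex w} {p : Fin w.length} (hp : v p = false)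
    (hv : Function.update v p true = braidVertex w) (q : Fin w.length) :
    ¬ Braidlike w v q ↔ q = p := by
  change ¬ v q = braidVertex w q ↔ q = p
  rw [← hv]
  rcases eq_or_ne q p with rfl | hq
  · simp [hp]
  · simp [hq]

/-- All edges into the braid-like resolution are splits. -/
lemma edgeCoeff_flipAt_right {p : Fin w.length} {S T : State w} (hp : S.1 p = false)
    (hST : T.1 = Function.update S.1 p true) (hT : T.1 = braidVertex w) :
    edgeCoeff w p S (flipAt w p T) = edgeCoeff w p S T := by
  obtain ⟨u, m⟩ := S
  obtain ⟨v, m'⟩ := T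
  obtain rfl : v = braidVertex w := hT
  have hbad := not_braidlike_iff_of_update_eq hp hST.symm
  have hbase : ∀ x, circ w u x = circ w u (0, x.2) :=
    circ_eq_of_subsingleton_not_braidlike fun q hq r hr =>
      ((hbad q).1 hq).trans ((hbad r).1 hr).symm
  have hsplit : circ w u (cornerA w p) = circ w u (cornerB w p) := by
    rw [cornerA, circ_castSucc_posL_eq_posR ((hbad p).2 rfl), hbase, hbase (cornerB w p)]
    rfl
  have hcirc : ∀ x y, circ w (braidVertex w) x = circ w (braidVertex w) y →
      circ w u x = circ w u y := fun x y h => by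
    rw [hbase, (circ_braidVertex_eq_iff x y).1 h, ← hbase]
  simp only [edgeCoeff, flipAt, ne_eq, hsplit, not_true_eq_false, if_false, if_true, true_or,
    or_true, comulCoeff_not_not]
  congr 1
  refine propext (forall_congr' fun x => forall₂_congr fun hA hB => ?_)
  have hxA := mt (hcirc x (cornerA w p)) (hsplit ▸ hA)
  have hxB := mt (hcirc x (cornerB w p)) hB
  simp [hxA, hxB]

lemma canonMark_not (j : Fin n) (m : Bool) :
    canonMark n j (!m) = canonMark n j true * canonMark n j m := by
  by_cases h : Even (n - 1 - j.val) <;> cases m <;> simp [canonMark, h]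

lemma canonMark_mul_self (j : Fin n) (m : Bool) : canonMark n j m * canonMark n j m = 1 := by
  by_cases h : Even (n - 1 - j.val) <;> cases m <;> simp [canonMark, h]

lemma canonMark_posL_mul_posR (p : Fin w.length) :
    canonMark n (posL w p) true * canonMark n (posR w p) true = -1 := by
  have hi := (w.get p).1.isLt
  have h : n - 1 - (posL w p).val = n - 1 - (posR w p).val + 1 := by
    simp only [posL, posR]
    omega
  by_cases he : Even (n - 1 - (posR w p).val) <;> simp [canonMark, h, Nat.even_add_one, he]

lemma canonMark_flipAt_braidVertex (p : Fin w.length) (m : Circle w (braidVertex w) → Bool)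
    (j : Fin n) :
    canonMark n j ((flipAt w p ⟨braidVertex w, m⟩).2 (circ w (braidVertex w) (0, j))) =
      ((if j = posL w p then canonMark n j true else 1) *
        (if j = posR w p then canonMark n j true else 1)) *
          canonMark n j (m (circ w (braidVertex w) (0, j))) := by
  have hne := posL_ne_posR p
  simp only [flipAt, circ_braidVertex_eq_iff, cornerA, cornerB]
  rcases eq_or_ne j (posL w p) with rfl | hL
  · simp [canonMark_not, hne]
  rcases eq_or_ne j (posR w p) with rfl | hR
  · simp [canonMark_not, hne.symm]
  · simp [hL, hR]

lemma canonCycle_flipAt (w : BraidWord n) (p : Fin w.length) (S : State w) :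
    canonCycle w (flipAt w p S) = -canonCycle w S := by
  obtain ⟨v, m⟩ := S
  rcases eq_or_ne v (braidVertex w) with rfl | hv
  · have hprod : ∏ j : Fin n,
        canonMark n j ((flipAt w p ⟨braidVertex w, m⟩).2 (circ w (braidVertex w) (0, j))) =
          -∏ j : Fin n, canonMark n j (m (circ w (braidVertex w) (0, j))) := by
      simp only [canonMark_flipAt_braidVertex, Finset.prod_mul_distrib, Finset.prod_ite_eq',
        Finset.mem_univ, if_true, canonMark_posL_mul_posR, neg_mul, one_mul]
    simpa [canonCycle, flipAt] using hprod
  · simp [canonCycle, flipAt, hv]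

lemma eq_braidVertex_of_canonCycle_ne_zero {S : State w} (h : canonCycle w S ≠ 0) :
    S.1 = braidVertex w := by
  by_contra hS
  exact h (if_neg hS)

/-- The contribution of the edges that change the resolution of the crossing `p` to the matrix
coefficients of the Lee differential. -/
noncomputable def signedEdgeCoeff (w : BraidWord n) (p : Fin w.length) (S T : State w) : ℂ :=
  if S.1 p = false ∧ T.1 = Function.update S.1 p true then
    (-1 : ℂ) ^ (Finset.univ.filter fun q : Fin w.length => q < p ∧ S.1 q = true).card *
      edgeCoeff w p S T
  else 0

lemma leeCoeff_eq_sum (w : BraidWord n) (S T : State w) :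
    leeCoeff w S T = ∑ p, signedEdgeCoeff w p S T := rfl

lemma signedEdgeCoeff_flipAt_left (p : Fin w.length) {S : State w} (hS : S.1 = braidVertex w)
    (T : State w) : signedEdgeCoeff w p (flipAt w p S) T = signedEdgeCoeff w p S T := by
  rw [signedEdgeCoeff, edgeCoeff_flipAt_left p hS]
  rfl

lemma signedEdgeCoeff_flipAt_right (p : Fin w.length) (S : State w) {T : State w}
    (hT : T.1 = braidVertex w) :
    signedEdgeCoeff w p S (flipAt w p T) = signedEdgeCoeff w p S T := by
  refine ite_congr rfl (fun h => ?_) fun _ => rfl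
  rw [edgeCoeff_flipAt_right h.1 h.2 hT]

lemma sum_signedEdgeCoeff_mul_canonCycle (w : BraidWord n) (p : Fin w.length) (T : State w) :
    ∑ S, signedEdgeCoeff w p S T * canonCycle w S = 0 := by
  refine sum_eq_zero_of_perm_neg (flipAt_involutive w p).toPerm fun S => ?_
  rw [Function.Involutive.coe_toPerm, canonCycle_flipAt, mul_neg]
  by_cases hS : canonCycle w S = 0
  · simp [hS]
  · rw [signedEdgeCoeff_flipAt_left p (eq_braidVertex_of_canonCycle_ne_zero hS)]

lemma sum_canonCycle_mul_signedEdgeCoeff (w : BraidWord n) (p : Fin w.length) (S : State w) :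
    ∑ T, canonCycle w T * signedEdgeCoeff w p S T = 0 := by
  refine sum_eq_zero_of_perm_neg (flipAt_involutive w p).toPerm fun T => ?_
  rw [Function.Involutive.coe_toPerm, canonCycle_flipAt, neg_mul]
  by_cases hT : canonCycle w T = 0
  · simp [hT]
  · rw [signedEdgeCoeff_flipAt_right p S (eq_braidVertex_of_canonCycle_ne_zero hT)]

lemma leeDiff_canonCycle (w : BraidWord n) : leeDiff w (canonCycle w) = 0 := by
  funext T
  simp only [leeDiff, Matrix.mulVecLin_apply, Matrix.mulVec, dotProduct, Matrix.of_apply,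
    leeCoeff_eq_sum, Finset.sum_mul, Pi.zero_apply]
  rw [Finset.sum_comm]
  exact Finset.sum_eq_zero fun p _ => sum_signedEdgeCoeff_mul_canonCycle w p T

lemma canonCycle_dotProduct_leeDiff (w : BraidWord n) (x : Chain w) :
    canonCycle w ⬝ᵥ leeDiff w x = 0 := by
  have hker : Matrix.vecMul (canonCycle w) (Matrix.of fun T S => leeCoeff w S T) = 0 := by
    funext S
    simp only [Matrix.vecMul, dotProduct, Matrix.of_apply, leeCoeff_eq_sum, Finset.mul_sum,
      Pi.zero_apply]
    rw [Finset.sum_comm]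
    exact Finset.sum_eq_zero fun p _ => sum_canonCycle_mul_signedEdgeCoeff w p S
  rw [leeDiff, Matrix.mulVecLin_apply, Matrix.dotProduct_mulVec, hker, zero_dotProduct]

lemma canonCycle_dotProduct_self_ne_zero (w : BraidWord n) : canonCycle w ⬝ᵥ canonCycle w ≠ 0 := by
  have hsq : ∀ S, canonCycle w S * canonCycle w S = if S.1 = braidVertex w then 1 else 0 := by
    intro S
    by_cases hS : S.1 = braidVertex w <;>
      simp [canonCycle, hS, ← Finset.prod_mul_distrib, canonMark_mul_self]
  simp only [dotProduct, hsq, Finset.sum_boole, Nat.cast_ne_zero, Finset.card_ne_zero]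
  exact ⟨⟨braidVertex w, fun _ => true⟩, by simp⟩

lemma canonCycle_mem_canonReps (w : BraidWord n) : canonCycle w ∈ canonReps w :=
  ⟨leeDiff_canonCycle w, by simp⟩

lemma ne_zero_of_mem_canonReps {x : Chain w} (hx : x ∈ canonReps w) : x ≠ 0 := by
  rintro rfl
  obtain ⟨y, hy⟩ := hx.2
  have := canonCycle_dotProduct_leeDiff w y
  rw [hy, zero_sub, dotProduct_neg, neg_eq_zero] at this
  exact canonCycle_dotProduct_self_ne_zero w this

/-! ### The annular Rasmussen invariant -/

lemma isLeast_chainGr {x : Chain w} (hx : x ≠ 0) (t : ℝ) :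
    IsLeast (jtGr w t '' x.support) (chainGr w t x) := by
  have hne : (jtGr w t '' x.support).Nonempty := (Function.support_nonempty_iff.2 hx).image _
  have hfin : (jtGr w t '' x.support).Finite := Set.toFinite _
  have hlower : {s | x ∈ filt w t s} = lowerBounds (jtGr w t '' x.support) := by
    ext s
    exact Set.forall_mem_image.symm
  rw [chainGr, hlower, csSup_lowerBounds_eq_csInf hfin.bddBelow hne]
  exact ⟨hne.csInf_mem hfin, fun _ hs => csInf_le hfin.bddBelow hs⟩

lemma isGreatest_annularRasmussen (w : BraidWord n) (t : ℝ) :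
    IsGreatest (chainGr w t '' canonReps w) (annularRasmussen w t) := by
  have hne : (chainGr w t '' canonReps w).Nonempty := ⟨_, _, canonCycle_mem_canonReps w, rfl⟩
  have hfin : (chainGr w t '' canonReps w).Finite := by
    refine (Set.finite_range (jtGr w t)).subset ?_
    rintro _ ⟨x, hx, rfl⟩
    exact Set.image_subset_range _ _ (isLeast_chainGr (ne_zero_of_mem_canonReps hx) t).1
  exact ⟨hne.csSup_mem hfin, fun _ hs => le_csSup hfin.bddAbove hs⟩

lemma exists_annularRasmussen_eq_jtGr (w : BraidWord n) (t : ℝ) :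
    ∃ S, annularRasmussen w t = jtGr w t S := by
  obtain ⟨x, hx, hxt⟩ := (isGreatest_annularRasmussen w t).1
  obtain ⟨S, -, hS⟩ := (isLeast_chainGr (ne_zero_of_mem_canonReps hx) t).1
  exact ⟨S, hxt.symm.trans hS.symm⟩

lemma chainGr_le_add {x : Chain w} (hx : x ≠ 0) (s t : ℝ) :
    chainGr w s x ≤ chainGr w t x + n * |s - t| := by
  obtain ⟨S, hS, hSt⟩ := (isLeast_chainGr hx t).1
  calc chainGr w s x ≤ jtGr w s S := (isLeast_chainGr hx s).2 ⟨S, hS, rfl⟩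
    _ ≤ jtGr w t S + n * |s - t| := jtGr_le_add S s t
    _ = chainGr w t x + n * |s - t| := by rw [hSt]

lemma lipschitzWith_annularRasmussen (w : BraidWord n) : LipschitzWith n (annularRasmussen w) := by
  refine LipschitzWith.of_le_add_mul _ fun s t => ?_
  obtain ⟨x, hx, hxs⟩ := (isGreatest_annularRasmussen w s).1
  calc annularRasmussen w s = chainGr w s x := hxs.symm
    _ ≤ chainGr w t x + n * |s - t| := chainGr_le_add (ne_zero_of_mem_canonReps hx) s t
    _ ≤ annularRasmussen w t + n * |s - t| := by
        gcongr
        exact (isGreatest_annularRasmussen w t).2 ⟨x, hx, rfl⟩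

lemma selfLinking_add_le_annularRasmussen (w : BraidWord n) {t : ℝ} (ht : t ≤ 1) :
    selfLinking w + t * n ≤ annularRasmussen w t := by
  have hmem := canonCycle_mem_canonReps w
  refine le_trans ?_ ((isGreatest_annularRasmussen w t).2 ⟨_, hmem, rfl⟩)
  obtain ⟨S, hS, hSt⟩ := (isLeast_chainGr (ne_zero_of_mem_canonReps hmem) t).1
  have hk : -(n : ℝ) ≤ kGr w S := by exact_mod_cast (abs_le.1 (abs_kGr_le S)).1
  rw [← hSt, jtGr_of_eq_braidVertex (eq_braidVertex_of_canonCycle_ne_zero hS)]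
  exact le_add_of_nonneg_right (mul_nonneg (by linarith) (by linarith))

lemma hasRightSlope_iff {t m : ℝ} :
    HasRightSlope w t m ↔ HasDerivWithinAt (annularRasmussen w) m (Set.Ioi t) t := by
  have hmap : map (t + ·) (𝓝[>] 0) = 𝓝[>] t := by simp
  rw [hasDerivWithinAt_iff_tendsto_slope' Set.self_notMem_Ioi, ← hmap, tendsto_map'_iff]
  simp [HasRightSlope, slope_fun_def_field, Function.comp_def]

lemma hasDerivAt_jtGr (S : State w) (t : ℝ) :
    HasDerivAt (fun t => jtGr w t S) (-(kGr w S : ℝ)) t := by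
  simpa [jtGr] using ((hasDerivAt_id t).mul_const (kGr w S : ℝ)).const_sub (jGr w S : ℝ)

lemma annularRasmussen_eq_of_hasRightSlope {t : ℝ} (h : HasRightSlope w t n) :
    annularRasmussen w t = selfLinking w + t * n := by
  have hacc : AccPt t (𝓟 (Set.Ioi t)) := by
    rw [accPt_principal_iff_nhdsWithin]
    simpa using nhdsGT_neBot t
  obtain ⟨S, hval, hslope⟩ := exists_eq_and_deriv_eq_of_hasDerivWithinAt hacc
    (fun s _ => exists_annularRasmussen_eq_jtGr w s) (hasRightSlope_iff.1 h)
    fun S => (hasDerivAt_jtGr S t).hasDerivWithinAt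
  have hk : kGr w S = -n := by
    have : (kGr w S : ℝ) = -n := by rw [hslope, neg_neg]
    exact_mod_cast this
  rw [hval, jtGr_of_kGr_eq_neg hk]

lemma annularRasmussen_eq_of_hasRightSlope_of_le {t₀ t : ℝ} (h : HasRightSlope w t₀ n)
    (ht₀ : t₀ ≤ t) (ht : t ≤ 1) : annularRasmussen w t = selfLinking w + t * n := by
  refine le_antisymm ?_ (selfLinking_add_le_annularRasmussen w ht)
  calc annularRasmussen w t ≤ annularRasmussen w t₀ + n * dist t t₀ :=
        (lipschitzWith_annularRasmussen w).le_add_mul t t₀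
    _ = selfLinking w + t * n := by
        rw [annularRasmussen_eq_of_hasRightSlope h, Real.dist_eq, abs_of_nonneg (by linarith)]
        ring

end AnnularLee

theorem proposition5p10_general {n : ℕ} (w : AnnularLee.BraidWord n) {t₀ : ℝ}
    (h : AnnularLee.HasRightSlope w t₀ n) :
    ∀ t ∈ Set.Ico t₀ 1, AnnularLee.HasRightSlope w t n := by
  rintro t ⟨ht₀, ht⟩
  have hline : ∀ s ∈ Set.Icc t 1,
      AnnularLee.annularRasmussen w s = AnnularLee.selfLinking w + s * n := fun s hs =>
    AnnularLee.annularRasmussen_eq_of_hasRightSlope_of_le h (ht₀.trans hs.1) hs.2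
  have hderiv : HasDerivAt (fun s : ℝ => (AnnularLee.selfLinking w : ℝ) + s * n) n t := by
    simpa using ((hasDerivAt_id t).mul_const (n : ℝ)).const_add (AnnularLee.selfLinking w : ℝ)
  refine AnnularLee.hasRightSlope_iff.2 (hderiv.hasDerivWithinAt.congr_of_eventuallyEq ?_
    (hline t ⟨le_rfl, ht.le⟩))
  filter_upwards [Ioo_mem_nhdsGT ht] with s hs
  exact hline s ⟨hs.1.le, hs.2.le⟩

theorem proposition5p10 (n : ℕ) (σ : AnnularLee.BraidGroup n) (w : AnnularLee.BraidWord n)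
    (hw : AnnularLee.braidOf w = σ) (t₀ : ℝ) (ht₀ : t₀ ∈ Set.Ico (0 : ℝ) 1)
    (hslope : AnnularLee.HasRightSlope w t₀ (n : ℝ)) :
    ∀ t ∈ Set.Ico t₀ 1, AnnularLee.HasRightSlope w t (n : ℝ) :=
  proposition5p10_general w hslope
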